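/- **Setting.** Let $m\ge 1$, $H\in\mathbb R^{n\times n}$ symmetric positive semidefinite, $c\in\mathbb R^n$, $A\in\mathbb R^{m\times n}$ with rows $a_i^T$, $b\in\mathbb R^m$. Consider the convex quadratic program of minimizing $f(x)=\tfrac12x^THx+c^Tx$ subject to $Ax\ge b$. Write $\mathcal A(x)=\{i: a_i^Tx=b_i\}$. A pair $(x,\lambda)$ is a KKT pair if $Hx-A^T\lambda+c=0$, $Ax\ge b$, $\lambda\ge0$ and $\lambda_i(a_i^Tx-b_i)=0$ for all $i$. Norms $\|\cdot\|$ are Euclidean. $[v]_+$, $[v]_-$ have components $\max\{v_i,0\}$, $\min\{v_i,0\}$. **Parameters.** $\varepsilon\ge 0$, $\tau\in[0,1)$, $\omega,\varkappa\in(0,1)$, $\nu\ge2$, $\lambda^{\max}>0$, $\underline\lambda\in(0,\lambda^{\max})$, $\bar E>0$, and a symmetric $R\succeq0$ with $H+R\succ0$. Let $E(x,\lambda)=\bigl\|\bigl(\|Hx+c-A^T\lambda\|,\|w\|\bigr)\bigr\|$ with $w_i=\min\{|a_i^Tx-b_i|,|\lambda_i|\}$, where the three norms are arbitrary but fixed norms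 on $\mathbb R^2$, $\mathbb R^n$, $\mathbb R^m$. **One CR-MPC step.** The input is $x$, $s=Ax-b>0$, $\lambda>0$, $\tilde\lambda\in\mathbb R^m$, and a working set $Q\subseteq\{1,\dots,m\}$. The iteration stops if $\nabla f(x)=0$ or $\min\{E(x,\lambda),E(x,[\tilde\lambda]_+)\}<\varepsilon$. Otherwise: 1. Put $\varrho=\min\{1,E(x,\lambda)/\bar E\}$, $W=H+\varrho R$ and $M=W+\sum_{i\in Q}\frac{\lambda_i}{s_i}a_ia_i^T$. Solve $M\Delta x^{a}=-\nabla f(x)$; set $\Delta s^{a}=A\Delta x^{a}$ and $\Delta\lambda^{a}_i=-\lambda_i-\frac{\lambda_i}{s_i}\Delta s^{a}_i$ for $i\in Q$. 2. Let $\alpha^{a}$ be the largest $\alpha\in[0,1]$ with $s+\alpha\Delta s^{a}\ge0$ and $\lambda_i+\alpha\Delta\lambda^{a}_i\ge0$ for $i\in Q$. Let $\sigma=(1-\alpha^{a})^3$, and let $\mu=\frac1{|Q|}\sum_{i\in Q}s_i\lambda_i$ ($\mu=0$ if $Q=\emptyset$). 3. Solve $W\Delta x^{c}-\sum_{i\in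 Q}\Delta\lambda^{c}_ia_i=0$, $\Delta s^{c}=A\Delta x^{c}$, $s_i\Delta\lambda^{c}_i+\lambda_i\Delta s^{c}_i=\sigma\mu-\Delta s^{a}_i\Delta\lambda^{a}_i$ for $i\in Q$. 4. Let $\gamma_1$ be the largest $g\in[0,1]$ with $f(x)-f(x+\Delta x^{a}+g\Delta x^{c})\ge\omega\,(f(x)-f(x+\Delta x^{a}))$. Let $\gamma=0$ if $Q=\emptyset$; otherwise $\gamma=1$ if $\Delta x^{c}=0$, and otherwise $\gamma=\min\{\gamma_1,\ \tau\|\Delta x^{a}\|/\|\Delta x^{c}\|,\ \tau\|\Delta x^{a}\|/(\sigma\mu)\}$ (the last term being omitted if $\sigma\mu=0$). Put $(\Delta x,\Delta\lambda_Q,\Delta s)=(\Delta x^{a},\Delta\lambda^{a}_Q,\Delta s^{a})+\gamma(\Delta x^{c},\Delta\lambda^{c}_Q,\Delta s^{c})$, $\tilde\lambda^+_i=\lambda_i+\Delta\lambda_i$ for $i\in Q$, and $\tilde\lambda^+_i=0$ for $i\notin Q$. 5. With $\bar\alpha_p=\max\{\alpha:s+\alpha\Delta s\ge0\}$ and $\bar\alpha_d=\max\{\alpha:\lambda_i+\alpha\Delta\lambda_i\ge0\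 \forall i\in Q\}$ (possibly $+\infty$), put $\alpha_\bullet=\min\{1,\max\{\varkappa\bar\alpha_\bullet,\bar\alpha_\bullet-\|\Delta x\|\}\}$ for $\bullet=p,d$. Set $(x^+,s^+)=(x,s)+\alpha_p(\Delta x,\Delta s)$. 6. Let $\chi=\|\Delta x^{a}\|^\nu+\|[\lambda_Q+\Delta\lambda^{a}_Q]_-\|^\nu$. Set $\lambda_i^+=\max\{\min\{\lambda_i+\alpha_d\Delta\lambda_i,\lambda^{\max}\},\min\{\chi,\underline\lambda\}\}$ for $i\in Q$. With $\mu^+=\frac1{|Q|}\sum_{i\in Q}s_i^+\lambda_i^+$ ($\mu^+=0$ if $Q=\emptyset$), set $\lambda_i^+=\max\{\min\{\mu^+/s_i^+,\lambda^{\max}\},\min\{\chi,\underline\lambda\}\}$ for $i\notin Q$. **Theorem.** Let $(x^*,\lambda^*)$ be a KKT pair at which the second-order sufficient condition with strict complementarity holds and $\lambda^*$ is the only multiplier. That is, $\lambda^*_i>0$ for all $i\in\mathcal A(x^*)$; $d^THd>0$ for every $d\ne0$ in the critical cone $\{d: a_i^Td=0\text{ if }i\in\mathcal A(x^*),\lambda_i^*>0;\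 a_i^Td\ge0\text{ if }i\in\mathcal A(x^*),\lambda^*_i=0\}$; and $(x^*,\lambda)$ is a KKT pair only for $\lambda=\lambda^*$. Assume $\varepsilon=0$ and $\lambda^*_i<\lambda^{\max}$ for all $i$. Then there exist $\rho>0$ and $C>0$ such that, for every input $(x,s,\lambda,\tilde\lambda)$ as above at which the iteration does not stop and every working set $Q$, if $\|(x-x^*,\lambda-\lambda^*)\|<\rho$ and $Q\supseteq\mathcal A(x^*)$, then the CR-MPC step satisfies $$\|(x^+-x^*,\tilde\lambda^+-\lambda^*)\|\le C\,\|(x-x^*,\lambda-\lambda^*)\|^2 .$$ -/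

import Mathlib

open Matrix

noncomputable section

/-- The Euclidean norm of a finite real vector. -/
def euclNorm {ι : Type} [Fintype ι] (v : ι → ℝ) : ℝ := ‖WithLp.toLp 2 v‖

/-- The convex quadratic program: minimize `(1/2) xᵀ H x + cᵀ x` subject to `A x ≥ b`, with `m > 0`
inequality constraints and `H` symmetric positive semidefinite. -/
structure CQP (n m : ℕ) where
  H : Matrix (Fin n) (Fin n) ℝ
  c : Fin n → ℝ
  A : Matrix (Fin m) (Fin n) ℝ
  b : Fin m → ℝ
  m_pos : 0 < m
  H_posSemidef : H.PosSemidef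

namespace CQP

variable {n m : ℕ} (P : CQP n m)

/-- The objective function. -/
def f (x : Fin n → ℝ) : ℝ := (1 / 2 : ℝ) * (x ⬝ᵥ P.H *ᵥ x) + P.c ⬝ᵥ x

/-- The gradient of the objective function. -/
def gradf (x : Fin n → ℝ) : Fin n → ℝ := P.H *ᵥ x + P.c

/-- The slack vector `A x - b`. -/
def slack (x : Fin n → ℝ) : Fin m → ℝ := P.A *ᵥ x - P.b

/-- The set of active constraints at `x`. -/
def active (x : Fin n → ℝ) : Set (Fin m) := {i | (P.A *ᵥ x) i = P.b i}

/-- The Karush-Kuhn-Tucker conditions; equivalently, `(x, lam)` is a primal-dual solution. -/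
structure IsKKT (x : Fin n → ℝ) (lam : Fin m → ℝ) : Prop where
  stationarity : P.H *ᵥ x - P.Aᵀ *ᵥ lam + P.c = 0
  complementarity : ∀ i, P.slack x i * lam i = 0
  slack_nonneg : ∀ i, 0 ≤ P.slack x i
  lam_nonneg : ∀ i, 0 ≤ lam i

/-- The critical cone at `x` associated with the multiplier `lam`. -/
def criticalCone (x : Fin n → ℝ) (lam : Fin m → ℝ) : Set (Fin n → ℝ) :=
  {d | (∀ i ∈ P.active x, 0 < lam i → (P.A *ᵥ d) i = 0) ∧
    (∀ i ∈ P.active x, lam i = 0 → 0 ≤ (P.A *ᵥ d) i)}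

/-- The second-order sufficient condition of optimality with strict complementarity holds at `x`,
with `lam` as the unique multiplier. -/
structure SecondOrderStrict (x : Fin n → ℝ) (lam : Fin m → ℝ) : Prop where
  kkt : P.IsKKT x lam
  strict_complementarity : ∀ i ∈ P.active x, 0 < lam i
  second_order : ∀ d ∈ P.criticalCone x lam, d ≠ 0 → 0 < d ⬝ᵥ P.H *ᵥ d
  unique_multiplier : ∀ lam₂ : Fin m → ℝ, P.IsKKT x lam₂ → lam₂ = lam

end CQP

/-- Parameters of the algorithm. The three (arbitrary) norms `normV`, `normW`, `normE`, on `ℝⁿ`,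
`ℝᵐ` and `ℝ²`, are those that enter the error function; see `MPCParams.Valid` for
their definiteness. -/
structure MPCParams (n m : ℕ) where
  eps : ℝ
  tau : ℝ
  omega : ℝ
  kappa : ℝ
  nu : ℝ
  lamMax : ℝ
  lamLow : ℝ
  Ebar : ℝ
  R : Matrix (Fin n) (Fin n) ℝ
  normV : Seminorm ℝ (Fin n → ℝ)
  normW : Seminorm ℝ (Fin m → ℝ)
  normE : Seminorm ℝ (ℝ × ℝ)

/-- The requirements on the parameters. -/
structure MPCParams.Valid {n m : ℕ} (p : MPCParams n m) (P : CQP n m) : Prop where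
  eps_nonneg : 0 ≤ p.eps
  tau_mem : p.tau ∈ Set.Ico (0 : ℝ) 1
  omega_mem : p.omega ∈ Set.Ioo (0 : ℝ) 1
  kappa_mem : p.kappa ∈ Set.Ioo (0 : ℝ) 1
  two_le_nu : 2 ≤ p.nu
  lamMax_pos : 0 < p.lamMax
  lamLow_mem : p.lamLow ∈ Set.Ioo 0 p.lamMax
  Ebar_pos : 0 < p.Ebar
  R_posSemidef : p.R.PosSemidef
  H_add_R_posDef : (P.H + p.R).PosDef
  normV_def : ∀ v, p.normV v = 0 → v = 0
  normW_def : ∀ w, p.normW w = 0 → w = 0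
  normE_def : ∀ e, p.normE e = 0 → e = 0

/-- What the iteration takes as input and produces as output: `x`, `s`, `λ` and `λ̃`. -/
structure MPCIterate (n m : ℕ) where
  x : Fin n → ℝ
  s : Fin m → ℝ
  lam : Fin m → ℝ
  lamTilde : Fin m → ℝ

/-- Intermediate quantities of one iteration. Only the entries with index in the working set of
the vectors `dlamAff`, `dlamCor`, `dlam` are meaningful (and only those are ever used). -/
structure MPCStepData (n m : ℕ) where
  dxAff : Fin n → ℝ
  dsAff : Fin m → ℝ
  dlamAff : Fin m → ℝ
  alphaAff : ℝ
  sigma : ℝ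
  dxCor : Fin n → ℝ
  dsCor : Fin m → ℝ
  dlamCor : Fin m → ℝ
  gamma1 : ℝ
  gamma : ℝ
  dx : Fin n → ℝ
  ds : Fin m → ℝ
  dlam : Fin m → ℝ
  alphaP : ℝ
  alphaD : ℝ
  chi : ℝ

/-- `α = min {1, max {kappa ᾱ, ᾱ - r}}` where `ᾱ` is the largest element of `S`, with the
convention `ᾱ = +∞` (so that `α = 1`) when `S` is unbounded above. -/
def IsStepLength (kappa r : ℝ) (S : Set ℝ) (α : ℝ) : Prop :=
  (∃ αbar, IsGreatest S αbar ∧ α = min 1 (max (kappa * αbar) (αbar - r))) ∨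
    (¬ BddAbove S ∧ α = 1)

/-- The duality measure `s_Qᵀ lam_Q / |Q|` of the working set `Q` (zero if `Q` is empty). -/
def dualityMeasure {m : ℕ} (Q : Finset (Fin m)) (s lam : Fin m → ℝ) : ℝ :=
  if Q = ∅ then 0 else (∑ i ∈ Q, s i * lam i) / (Q.card : ℝ)

namespace CQP

variable {n m : ℕ} (P : CQP n m) (p : MPCParams n m)

/-- The error function `E(x, λ)`. -/
def errorE (x : Fin n → ℝ) (lam : Fin m → ℝ) : ℝ :=
  p.normE (p.normV (P.H *ᵥ x + P.c - P.Aᵀ *ᵥ lam),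
    p.normW (fun i => min |P.slack x i| |lam i|))

/-- The regularization parameter `min {1, E(x, λ) / Ē}`. -/
def regParam (x : Fin n → ℝ) (lam : Fin m → ℝ) : ℝ := min 1 (P.errorE p x lam / p.Ebar)

/-- The regularized Hessian. -/
def regHessian (x : Fin n → ℝ) (lam : Fin m → ℝ) : Matrix (Fin n) (Fin n) ℝ :=
  P.H + P.regParam p x lam • p.R

/-- The approximate normal matrix for the working set `Q`. -/
def normalMatrix (Q : Finset (Fin m)) (z : MPCIterate n m) : Matrix (Fin n) (Fin n) ℝ :=
  P.regHessian p z.x z.lam + ∑ i ∈ Q, (z.lam i / z.s i) • vecMulVec (P.A i) (P.A i)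

/-- Admissible inputs of the iteration: `x` strictly primal feasible, `s = A x - b`, `λ > 0`. -/
structure IsAdmissible (z : MPCIterate n m) : Prop where
  s_eq : z.s = P.slack z.x
  s_pos : ∀ i, 0 < z.s i
  lam_pos : ∀ i, 0 < z.lam i

/-- The stopping criterion, tested at the beginning of the iteration. -/
def Stops (z : MPCIterate n m) : Prop :=
  P.gradf z.x = 0 ∨
    min (P.errorE p z.x z.lam) (P.errorE p z.x (fun i => max (z.lamTilde i) 0)) < p.eps

/-- One (non-terminating) iteration with working set `Q` turns `z` into `zNew`, with intermediate
quantities `d`. -/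
structure IsStep (Q : Finset (Fin m)) (z : MPCIterate n m) (d : MPCStepData n m)
    (zNew : MPCIterate n m) : Prop where
  /- Affine-scaling direction. -/
  dxAff_eq : P.normalMatrix p Q z *ᵥ d.dxAff = -P.gradf z.x
  dsAff_eq : d.dsAff = P.A *ᵥ d.dxAff
  dlamAff_eq : ∀ i ∈ Q, d.dlamAff i = -z.lam i - z.lam i / z.s i * d.dsAff i
  /- Affine-scaling step size and centering parameter. -/
  alphaAff_eq : IsGreatest {α : ℝ | α ∈ Set.Icc (0 : ℝ) 1 ∧
    (∀ i, 0 ≤ z.s i + α * d.dsAff i) ∧ ∀ i ∈ Q, 0 ≤ z.lam i + α * d.dlamAff i} d.alphaAff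
  sigma_eq : d.sigma = (1 - d.alphaAff) ^ 3
  /- Centering-corrector direction: the three block rows of the regularized reduced Newton
  system. -/
  dxCor_eq : P.regHessian p z.x z.lam *ᵥ d.dxCor - ∑ i ∈ Q, d.dlamCor i • P.A i = 0
  dsCor_eq : d.dsCor = P.A *ᵥ d.dxCor
  dlamCor_eq : ∀ i ∈ Q, z.s i * d.dlamCor i + z.lam i * d.dsCor i =
    d.sigma * dualityMeasure Q z.s z.lam - d.dsAff i * d.dlamAff i
  /- Mixing parameter; in the minimum, a term with denominator zero counts as `+∞`. -/
  gamma1_eq : IsGreatest {g : ℝ | g ∈ Set.Icc (0 : ℝ) 1 ∧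
    p.omega * (P.f z.x - P.f (z.x + d.dxAff)) ≤
      P.f z.x - P.f (z.x + d.dxAff + g • d.dxCor)} d.gamma1
  gamma_empty : Q = ∅ → d.gamma = 0
  gamma_one : Q ≠ ∅ → d.dxCor = 0 → d.gamma = 1
  gamma_min : Q ≠ ∅ → d.dxCor ≠ 0 → d.sigma * dualityMeasure Q z.s z.lam ≠ 0 →
    d.gamma = min d.gamma1 (min (p.tau * (euclNorm d.dxAff / euclNorm d.dxCor))
      (p.tau * (euclNorm d.dxAff / (d.sigma * dualityMeasure Q z.s z.lam))))
  gamma_min_zero : Q ≠ ∅ → d.dxCor ≠ 0 → d.sigma * dualityMeasure Q z.s z.lam = 0 →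
    d.gamma = min d.gamma1 (p.tau * (euclNorm d.dxAff / euclNorm d.dxCor))
  /- Search direction. -/
  dx_eq : d.dx = d.dxAff + d.gamma • d.dxCor
  ds_eq : d.ds = d.dsAff + d.gamma • d.dsCor
  dlam_eq : ∀ i ∈ Q, d.dlam i = d.dlamAff i + d.gamma * d.dlamCor i
  lamTilde_mem : ∀ i ∈ Q, zNew.lamTilde i = z.lam i + d.dlam i
  lamTilde_notMem : ∀ i ∉ Q, zNew.lamTilde i = 0
  /- Primal and dual step sizes. -/
  alphaP_eq : IsStepLength p.kappa (euclNorm d.dx)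
    {α : ℝ | ∀ i, 0 ≤ z.s i + α * d.ds i} d.alphaP
  alphaD_eq : IsStepLength p.kappa (euclNorm d.dx)
    {α : ℝ | ∀ i ∈ Q, 0 ≤ z.lam i + α * d.dlam i} d.alphaD
  /- Updates. -/
  x_eq : zNew.x = z.x + d.alphaP • d.dx
  s_eq : zNew.s = z.s + d.alphaP • d.ds
  chi_eq : d.chi = euclNorm d.dxAff ^ p.nu +
    euclNorm (fun i : {i // i ∈ Q} => min (z.lam i + d.dlamAff i) 0) ^ p.nu
  lam_mem : ∀ i ∈ Q, zNew.lam i =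
    max (min (z.lam i + d.alphaD * d.dlam i) p.lamMax) (min d.chi p.lamLow)
  lam_notMem : ∀ i ∉ Q, zNew.lam i =
    max (min (dualityMeasure Q zNew.s zNew.lam / zNew.s i) p.lamMax) (min d.chi p.lamLow)

end CQP

end

open Filter Topology Asymptotics

/-! Write `e` for the distance of `(x, λ)` to the solution. A unique multiplier with strict
complementarity makes the active gradients independent. With the second-order condition, the Newton
matrix for `Q` is then nonsingular at the solution (`SecondOrderStrict.ker_newtonMap`), so nearby
Newton systems bound their solutions by their right-hand sides
(`SecondOrderStrict.isBigO_of_newtonMap`).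

The error after a full affine step solves such a system with right-hand side `O(e²)`: the products
`(s - s*)(λ - λ*)`, and the regularization term, quadratic because `E = O(e)`. The corrector is
`O(e²)` too: its right-hand side contains products of two affine steps and the centering `σμ`, where
`σ = (1 - αᵃ)³ = O(e³)`. As `0 ≤ γ ≤ 1`, the full combined step has error `O(e²)`, which settles the
multipliers.

The primal step is damped by `αₚ`, so `1 - αₚ = O(e)` is also needed
(`StepFamily.isBigO_one_sub_alphaP`). An active slack may be far smaller than `e`, so its change
must be controlled relative to the slack itself; linearized complementarity gives exactly this. -/

/-! ### Norms and matrices in asymptotic estimates -/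

theorem Seminorm.exists_le_mul_norm {E : Type*} [NormedAddCommGroup E] [NormedSpace ℝ E]
    [FiniteDimensional ℝ E] (q : Seminorm ℝ E) : ∃ C : ℝ, ∀ v, q v ≤ C * ‖v‖ := by
  let b := Module.finBasis ℝ E
  let L : E →L[ℝ] (Fin (Module.finrank ℝ E) → ℝ) :=
    LinearMap.toContinuousLinearMap b.equivFun.toLinearMap
  refine ⟨‖L‖ * ∑ i, q (b i), fun v => ?_⟩
  calc q v = q (∑ i, L v i • b i) := by
        congr 1; exact (b.sum_equivFun v).symm
    _ ≤ ∑ i, q (L v i • b i) := Finset.le_sum_of_subadditive q (map_zero q).le (map_add_le_add q) _ _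
    _ ≤ ∑ i, (‖L‖ * ‖v‖) * q (b i) := by
        refine Finset.sum_le_sum fun i _ => ?_
        rw [map_smul_eq_mul]
        exact mul_le_mul_of_nonneg_right ((norm_le_pi_norm (L v) i).trans (L.le_opNorm v))
          (apply_nonneg q _)
    _ = ‖L‖ * (∑ i, q (b i)) * ‖v‖ := by rw [← Finset.mul_sum]; ring

/-- Absorbs the arbitrary norms of the error function into constants. -/
theorem Seminorm.isBigO_comp {T E : Type*} [NormedAddCommGroup E] [NormedSpace ℝ E]
    [FiniteDimensional ℝ E] (q : Seminorm ℝ E) {l : Filter T} (v : T → E) :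
    (fun t => q (v t)) =O[l] v := by
  obtain ⟨C, hC⟩ := q.exists_le_mul_norm
  refine IsBigO.of_bound C (Eventually.of_forall fun t => ?_)
  rw [Real.norm_of_nonneg (apply_nonneg q _)]
  exact hC _

theorem Matrix.isBigO_mulVec {T κ ι : Type*} [Fintype κ] [Fintype ι] (M : Matrix κ ι ℝ)
    {l : Filter T} (v : T → ι → ℝ) : (fun t => M *ᵥ v t) =O[l] v :=
  (LinearMap.toContinuousLinearMap M.mulVecLin).isBigO_comp v l

theorem isBigO_euclNorm {T ι : Type} [Fintype ι] {l : Filter T} (v : T → ι → ℝ) :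
    (fun t => euclNorm (v t)) =O[l] v :=
  ((PiLp.continuousLinearEquiv 2 ℝ (fun _ : ι => ℝ)).symm.isBigO_comp v l).norm_left

theorem isBigO_of_euclNorm {T ι : Type} [Fintype ι] {l : Filter T} (v : T → ι → ℝ) :
    v =O[l] (fun t => euclNorm (v t)) :=
  ((PiLp.continuousLinearEquiv 2 ℝ (fun _ : ι => ℝ)).symm.isBigO_comp_rev v l).norm_right

theorem euclNorm_nonneg {ι : Type} [Fintype ι] (v : ι → ℝ) : 0 ≤ euclNorm v := norm_nonneg _

/-! ### Nonsingularity of the Newton system -/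

/-- The coefficient map of the Newton systems with working set `Q`, extended by the identity in the
dual components outside `Q`. -/
def newtonMap {n m : ℕ} (A : Matrix (Fin m) (Fin n) ℝ) (Q : Finset (Fin m))
    (W : Matrix (Fin n) (Fin n) ℝ) (s lam : Fin m → ℝ) :
    (Fin n → ℝ) × (Fin m → ℝ) →ₗ[ℝ] (Fin n → ℝ) × (Fin m → ℝ) where
  toFun w := (W *ᵥ w.1 - Aᵀ *ᵥ w.2,
    fun i => if i ∈ Q then s i * w.2 i + lam i * (A *ᵥ w.1) i else w.2 i)
  map_add' v w := by
    ext i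
    · simp [mulVec_add]; ring
    · by_cases h : i ∈ Q <;> simp [h, mulVec_add]; ring
  map_smul' r w := by
    ext i
    · simp [mulVec_smul]; ring
    · by_cases h : i ∈ Q <;> simp [h, mulVec_smul]; ring

theorem newtonMap_apply {n m : ℕ} (A : Matrix (Fin m) (Fin n) ℝ) (Q : Finset (Fin m))
    (W : Matrix (Fin n) (Fin n) ℝ) (s lam : Fin m → ℝ) (u : Fin n → ℝ) (v : Fin m → ℝ) :
    newtonMap A Q W s lam (u, v) = (W *ᵥ u - Aᵀ *ᵥ v,
      fun i => if i ∈ Q then s i * v i + lam i * (A *ᵥ u) i else v i) := rfl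

namespace CQP

variable {n m : ℕ} {P : CQP n m} {xStar : Fin n → ℝ} {lamStar : Fin m → ℝ}

theorem slack_eq_zero_iff {x : Fin n → ℝ} {i : Fin m} : P.slack x i = 0 ↔ i ∈ P.active x := by
  simp [slack, active, sub_eq_zero]

theorem slack_sub_slack (x y : Fin n → ℝ) : P.slack x - P.slack y = P.A *ᵥ (x - y) := by
  simp [slack, mulVec_sub]

theorem IsKKT.lam_eq_zero {x : Fin n → ℝ} {lam : Fin m → ℝ} (h : P.IsKKT x lam) {i : Fin m}
    (hi : i ∉ P.active x) : lam i = 0 :=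
  (mul_eq_zero.1 (h.complementarity i)).resolve_left (mt slack_eq_zero_iff.1 hi)

theorem IsKKT.slack_pos {x : Fin n → ℝ} {lam : Fin m → ℝ} (h : P.IsKKT x lam) {i : Fin m}
    (hi : i ∉ P.active x) : 0 < P.slack x i :=
  lt_of_le_of_ne (h.slack_nonneg i) (Ne.symm (mt slack_eq_zero_iff.1 hi))

/-- Strict complementarity and uniqueness of the multiplier make the active gradients linearly
independent. -/
theorem SecondOrderStrict.eq_zero_of_transpose_mulVec (h : P.SecondOrderStrict xStar lamStar)
    {v : Fin m → ℝ} (hv : ∀ i ∉ P.active xStar, v i = 0) (hA : P.Aᵀ *ᵥ v = 0) : v = 0 := by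
  -- For small `r > 0`, `lamStar + r • v` is again a multiplier: active entries stay positive and
  -- inactive ones stay zero. Uniqueness then forces `r • v = 0`.
  have key : ∀ᶠ r : ℝ in 𝓝[>] 0, ∀ i, 0 ≤ lamStar i + r * v i := by
    rw [eventually_all]
    intro i
    by_cases hi : i ∈ P.active xStar
    · have hc : Tendsto (fun r : ℝ => lamStar i + r * v i) (𝓝[>] 0) (𝓝 (lamStar i)) := by
        have : Continuous fun r : ℝ => lamStar i + r * v i := by fun_prop
        simpa using (this.tendsto 0).mono_left nhdsWithin_le_nhds
      filter_upwards [hc.eventually (lt_mem_nhds (h.strict_complementarity i hi))] with r hr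
      exact hr.le
    · simp [hv i hi, h.kkt.lam_nonneg i]
  obtain ⟨r, hr, hr0⟩ := (key.and self_mem_nhdsWithin).exists
  have hk : P.IsKKT xStar (lamStar + r • v) :=
    { stationarity := by
        rw [mulVec_add, mulVec_smul, hA, smul_zero, add_zero]
        exact h.kkt.stationarity
      complementarity := fun i => by
        by_cases hi : i ∈ P.active xStar
        · rw [slack_eq_zero_iff.2 hi, zero_mul]
        · simpa [hv i hi] using Or.inr (h.kkt.lam_eq_zero hi)
      slack_nonneg := h.kkt.slack_nonneg
      lam_nonneg := hr }
  have h2 : r • v = 0 := by simpa using h.unique_multiplier _ hk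
  exact (smul_eq_zero.1 h2).resolve_left (ne_of_gt hr0)

/-- For a kernel element `(u, v)`, the complementarity rows give `A u = 0` on active indices and `v
= 0` elsewhere. Thus `u` is critical and `uᵀHu = (A u)ᵀv = 0`, so `u = 0`; independence of the
active gradients then yields `v = 0`. -/
theorem SecondOrderStrict.ker_newtonMap (h : P.SecondOrderStrict xStar lamStar)
    {Q : Finset (Fin m)} (hQ : P.active xStar ⊆ (Q : Set (Fin m))) :
    LinearMap.ker (newtonMap P.A Q P.H (P.slack xStar) lamStar) = ⊥ := by
  rw [LinearMap.ker_eq_bot']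
  rintro ⟨u, v⟩ huv
  rw [newtonMap_apply, Prod.mk_eq_zero] at huv
  obtain ⟨h1, h2⟩ := huv
  have hAu : ∀ i ∈ P.active xStar, (P.A *ᵥ u) i = 0 := fun i hi => by
    have := congrFun h2 i
    have hiQ : i ∈ Q := hQ hi
    simpa [hiQ, slack_eq_zero_iff.2 hi, (h.strict_complementarity i hi).ne'] using this
  have hv : ∀ i ∉ P.active xStar, v i = 0 := fun i hi => by
    have := congrFun h2 i
    by_cases hiQ : i ∈ Q
    · simpa [hiQ, h.kkt.lam_eq_zero hi, (h.kkt.slack_pos hi).ne'] using this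
    · simpa [hiQ] using this
  have hu : u = 0 := by
    by_contra hne
    have hpos := h.second_order u ⟨fun i hi _ => hAu i hi, fun i hi _ => (hAu i hi).ge⟩ hne
    rw [sub_eq_zero.1 h1, mulVec_transpose, dotProduct_comm, ← dotProduct_mulVec] at hpos
    refine hpos.ne' (Finset.sum_eq_zero fun i _ => ?_)
    by_cases hi : i ∈ P.active xStar
    · rw [hAu i hi, mul_zero]
    · rw [hv i hi, zero_mul]
  have hAv : P.Aᵀ *ᵥ v = 0 := by simpa [hu] using h1
  rw [hu, h.eq_zero_of_transpose_mulVec hv hAv]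
  rfl

/-- Solutions of Newton systems near a strict second-order solution are bounded by the right-hand
side. -/
theorem SecondOrderStrict.isBigO_of_newtonMap (h : P.SecondOrderStrict xStar lamStar)
    {Q : Finset (Fin m)} (hQ : P.active xStar ⊆ (Q : Set (Fin m)))
    {T : Type*} {l : Filter T} {R : Matrix (Fin n) (Fin n) ℝ} {r g : T → ℝ}
    {s lam : T → Fin m → ℝ} {w : T → (Fin n → ℝ) × (Fin m → ℝ)}
    (hr : Tendsto r l (𝓝 0)) (hs : Tendsto s l (𝓝 (P.slack xStar)))
    (hlam : Tendsto lam l (𝓝 lamStar))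
    (hw : (fun t => newtonMap P.A Q (P.H + r t • R) (s t) (lam t) (w t)) =O[l] g) :
    w =O[l] g := by
  set L := newtonMap P.A Q P.H (P.slack xStar) lamStar
  have hL : w =O[l] fun t => L (w t) := by
    obtain ⟨K, -, hK⟩ := LinearMap.exists_antilipschitzWith L (h.ker_newtonMap hQ)
    refine IsBigO.of_bound K (Eventually.of_forall fun t => ?_)
    simpa using hK.le_mul_dist (w t) 0
  have h1 : (fun t => (w t).1) =O[l] w := isBigO_fst_prod'
  have h2 : (fun t => (w t).2) =O[l] w := isBigO_snd_prod'
  -- The coefficients converge to those of `L`, so replacing them by their limits costs `o(w)`.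
  have hdiff : (fun t => newtonMap P.A Q (P.H + r t • R) (s t) (lam t) (w t) - L (w t))
      =o[l] w := by
    have e : ∀ t, newtonMap P.A Q (P.H + r t • R) (s t) (lam t) (w t) - L (w t) =
        (r t • (R *ᵥ (w t).1), fun i => if i ∈ Q then
          (s t - P.slack xStar) i * (w t).2 i + (lam t - lamStar) i * (P.A *ᵥ (w t).1) i
          else 0) := fun t => by
      obtain ⟨u, v⟩ := w t
      simp only [L, newtonMap_apply, Prod.mk_sub_mk, Prod.mk.injEq, add_mulVec, smul_mulVec]
      refine ⟨by abel, funext fun i => ?_⟩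
      by_cases hi : i ∈ Q <;> simp [hi]; ring
    simp_rw [e]
    refine IsLittleO.prod_left ?_ (isLittleO_pi.2 fun i => ?_)
    · simpa using ((isLittleO_one_iff ℝ).2 hr).smul_isBigO ((R.isBigO_mulVec _).trans h1)
    · by_cases hi : i ∈ Q
      · simp only [hi, if_true]
        have hs' : Tendsto (fun t => (s t - P.slack xStar) i) l (𝓝 0) := by
          simpa using (tendsto_pi_nhds.1 hs i).sub_const (P.slack xStar i)
        have hl' : Tendsto (fun t => (lam t - lamStar) i) l (𝓝 0) := by
          simpa using (tendsto_pi_nhds.1 hlam i).sub_const (lamStar i)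
        have a1 := ((isLittleO_one_iff ℝ).2 hs').mul_isBigO (isBigO_pi.1 h2.norm_right i)
        have a2 := ((isLittleO_one_iff ℝ).2 hl').mul_isBigO
          (isBigO_pi.1 ((P.A.isBigO_mulVec _).trans h1).norm_right i)
        simpa only [one_mul, isLittleO_norm_right] using a1.add a2
      · simpa only [hi, if_false] using isLittleO_zero _ _
  -- The discrepancy is `o(L w)` and can be absorbed: `L w` is bounded by the perturbed image.
  have := (hdiff.trans_isBigO hL).right_isBigO_add
  simp only [sub_add_cancel] at this
  exact hL.trans (this.trans hw)

end CQP


/-! ### Step lengths and the duality measure -/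

/-- Once `θ ≤ B e < 1`, the value is at least `a - a (1 - B e)(1 + B e) = a (B e)²`, however small
`a` is. Stating it for all large `B` allows a common `B` for finitely many constraints. -/
theorem eventually_nonneg_add_mul_of_relative {T : Type*} {l : Filter T} {a δ θ e : T → ℝ}
    (ha : ∀ t, 0 < a t) (he : Tendsto e l (𝓝 0)) (he0 : ∀ t, 0 ≤ e t) (hθ : θ =O[l] e)
    (h : ∀ᶠ t in l, -a t * (1 + θ t) ≤ δ t) :
    ∀ᶠ B : ℝ in atTop, ∀ᶠ t in l, 0 ≤ a t + (1 - B * e t) * δ t := by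
  obtain ⟨C, hC⟩ := hθ.bound
  filter_upwards [eventually_ge_atTop C] with B hB
  have hBe : Tendsto (fun t => B * e t) l (𝓝 0) := by simpa using he.const_mul B
  filter_upwards [h, hC, hBe.eventually (gt_mem_nhds one_pos)] with t h1 h2 h3
  rw [Real.norm_eq_abs, Real.norm_of_nonneg (he0 t)] at h2
  have h4 : θ t ≤ B * e t :=
    (le_abs_self _).trans (h2.trans (mul_le_mul_of_nonneg_right hB (he0 t)))
  have h5 : -a t * (1 + B * e t) ≤ δ t :=
    (mul_le_mul_of_nonpos_left (by linarith) (by linarith [ha t])).trans h1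
  calc (0 : ℝ) ≤ a t * (B * e t) ^ 2 := mul_nonneg (ha t).le (sq_nonneg _)
    _ = a t + (1 - B * e t) * (-a t * (1 + B * e t)) := by ring
    _ ≤ a t + (1 - B * e t) * δ t := by
      linarith [mul_le_mul_of_nonneg_left h5 (by linarith : 0 ≤ 1 - B * e t)]

theorem eventually_nonneg_add_mul_of_tendsto_pos {T : Type*} {l : Filter T} {a δ e : T → ℝ} {c : ℝ}
    (hc : 0 < c) (ha : Tendsto a l (𝓝 c)) (hδ : Tendsto δ l (𝓝 0)) (he : Tendsto e l (𝓝 0)) :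
    ∀ᶠ B : ℝ in atTop, ∀ᶠ t in l, 0 ≤ a t + (1 - B * e t) * δ t := by
  refine Eventually.of_forall fun B => ?_
  have : Tendsto (fun t => a t + (1 - B * e t) * δ t) l (𝓝 (c + (1 - B * 0) * 0)) :=
    ha.add ((tendsto_const_nhds.sub (he.const_mul B)).mul hδ)
  rw [mul_zero, add_zero] at this
  filter_upwards [this.eventually (lt_mem_nhds hc)] with t ht using ht.le

/-- The branch `ᾱ - r` of the maximum provides the lower bound, as `ᾱ ≥ α₀`. -/
theorem IsStepLength.mem_Icc {kappa r α α₀ : ℝ} {S : Set ℝ} (h : IsStepLength kappa r S α)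
    (h₀ : α₀ ∈ S) (h₁ : α₀ ≤ 1) (hr : 0 ≤ r) : α ∈ Set.Icc (α₀ - r) 1 := by
  rcases h with ⟨β, hβ, rfl⟩ | ⟨-, rfl⟩
  · exact ⟨le_min (by linarith) ((sub_le_sub_right (hβ.2 h₀) r).trans (le_max_right _ _)),
      min_le_left _ _⟩
  · exact ⟨by linarith, le_rfl⟩

theorem dualityMeasure_nonneg {m : ℕ} {Q : Finset (Fin m)} {s lam : Fin m → ℝ}
    (hs : ∀ i, 0 < s i) (hlam : ∀ i, 0 < lam i) : 0 ≤ dualityMeasure Q s lam := by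
  unfold dualityMeasure
  split_ifs
  · exact le_rfl
  · exact div_nonneg (Finset.sum_nonneg fun i _ => (mul_pos (hs i) (hlam i)).le) (Nat.cast_nonneg _)

theorem isBigO_dualityMeasure {m : ℕ} (Q : Finset (Fin m)) {T : Type*} {l : Filter T}
    {s lam : T → Fin m → ℝ} (hs : s =O[l] fun _ => (1 : ℝ)) (hlam : lam =O[l] fun _ => (1 : ℝ)) :
    (fun t => dualityMeasure Q (s t) (lam t)) =O[l] fun _ => (1 : ℝ) := by
  unfold dualityMeasure
  by_cases hQ : Q = ∅
  · simp only [hQ, if_true]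
    exact isBigO_zero _ _
  · simp only [hQ, if_false, div_eq_mul_inv]
    have : (fun t => ∑ i ∈ Q, s t i * lam t i) =O[l] fun _ => (1 : ℝ) :=
      IsBigO.fun_sum fun i _ => by
        simpa using (isBigO_pi.1 hs i).mul (isBigO_pi.1 hlam i)
    simpa using this.mul (isBigO_const_const ((Q.card : ℝ)⁻¹) (one_ne_zero' ℝ) l)

theorem Matrix.transpose_mulVec_ite {n m : ℕ} (A : Matrix (Fin m) (Fin n) ℝ) (Q : Finset (Fin m))
    (v : Fin m → ℝ) : Aᵀ *ᵥ (fun i => if i ∈ Q then v i else 0) = ∑ i ∈ Q, v i • A i := by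
  rw [mulVec_transpose, vecMul_eq_sum]
  simp [ite_smul, Finset.sum_ite_mem]

/-! ### The two directions as solutions of Newton systems -/

namespace CQP

variable {n m : ℕ} {P : CQP n m} {p : MPCParams n m} {xStar : Fin n → ℝ} {lamStar : Fin m → ℝ}
  {Q : Finset (Fin m)}

/-- The problem is quadratic, so linearizing the KKT system leaves only the bilinear remainder `(s -
s*)(λ - λ*)`; regularizing the Hessian adds the `R` term. -/
theorem IsStep.newtonMap_aff {z zNew : MPCIterate n m} {d : MPCStepData n m}
    (h : P.IsStep p Q z d zNew) (hz : P.IsAdmissible z) (hk : P.IsKKT xStar lamStar)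
    (hQ : P.active xStar ⊆ (Q : Set (Fin m))) :
    newtonMap P.A Q (P.H + P.regParam p z.x z.lam • p.R) z.s z.lam
      (z.x + d.dxAff - xStar, fun i => if i ∈ Q then z.lam i + d.dlamAff i - lamStar i else 0) =
      (P.regParam p z.x z.lam • (p.R *ᵥ (z.x - xStar)), fun i => if i ∈ Q then
        (z.s - P.slack xStar) i * (z.lam - lamStar) i else 0) := by
  have hstar : P.Aᵀ *ᵥ lamStar = ∑ i ∈ Q, lamStar i • P.A i := by
    rw [← transpose_mulVec_ite]
    congr 1
    ext i
    by_cases hi : i ∈ Q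
    · simp [hi]
    · simp [hi, hk.lam_eq_zero fun h => hi (hQ h)]
  rw [newtonMap_apply, Prod.mk.injEq]
  constructor
  · have h1 := h.dxAff_eq
    -- This undoes the elimination behind the normal equations: `λᵢ + Δλᵢᵃ = -(λᵢ/sᵢ) aᵢᵀΔxᵃ`.
    have h2 : ∑ i ∈ Q, (z.lam i + d.dlamAff i - lamStar i) • P.A i =
        -((∑ i ∈ Q, (z.lam i / z.s i) • vecMulVec (P.A i) (P.A i)) *ᵥ d.dxAff) -
          P.Aᵀ *ᵥ lamStar := by
      rw [hstar, sum_mulVec, ← Finset.sum_neg_distrib, ← Finset.sum_sub_distrib]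
      refine Finset.sum_congr rfl fun i hi => ?_
      have hds : d.dsAff i = P.A i ⬝ᵥ d.dxAff := by rw [h.dsAff_eq]; rfl
      rw [h.dlamAff_eq i hi, smul_mulVec, vecMulVec_mulVec, hds]
      ext j
      simp
      ring
    rw [transpose_mulVec_ite, h2]
    have h3 := hk.stationarity
    rw [normalMatrix, regHessian, add_mulVec, gradf] at h1
    have h4 : z.x + d.dxAff - xStar = d.dxAff + (z.x - xStar) := by abel
    rw [h4, mulVec_add, add_mulVec _ _ (z.x - xStar), mulVec_sub, smul_mulVec]
    generalize (P.H + P.regParam p z.x z.lam • p.R) *ᵥ d.dxAff = a at *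
    generalize (∑ i ∈ Q, (z.lam i / z.s i) • vecMulVec (P.A i) (P.A i)) *ᵥ d.dxAff = b at *
    ext j
    have h1j := congrFun h1 j
    have h3j := congrFun h3 j
    simp only [Pi.add_apply, Pi.neg_apply, Pi.sub_apply, Pi.zero_apply] at *
    linarith
  · ext i
    by_cases hi : i ∈ Q
    · have hx : P.A *ᵥ (z.x + d.dxAff - xStar) = z.s - P.slack xStar + d.dsAff := by
        rw [h.dsAff_eq, hz.s_eq, slack_sub_slack, ← mulVec_add]
        congr 1
        abel
      have hc := hk.complementarity i
      have hs := (hz.s_pos i).ne'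
      simp only [hi, if_true, hx, Pi.add_apply, Pi.sub_apply, h.dlamAff_eq i hi]
      field_simp
      linear_combination -hc
    · simp [hi]

theorem IsStep.newtonMap_cor {z zNew : MPCIterate n m} {d : MPCStepData n m}
    (h : P.IsStep p Q z d zNew) :
    newtonMap P.A Q (P.H + P.regParam p z.x z.lam • p.R) z.s z.lam
      (d.dxCor, fun i => if i ∈ Q then d.dlamCor i else 0) =
      (0, fun i => if i ∈ Q then
        d.sigma * dualityMeasure Q z.s z.lam - d.dsAff i * d.dlamAff i else 0) := by
  rw [newtonMap_apply, Prod.mk.injEq]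
  constructor
  · rw [transpose_mulVec_ite]
    exact h.dxCor_eq
  · ext i
    by_cases hi : i ∈ Q
    · simp [hi, ← h.dlamCor_eq i hi, h.dsCor_eq]
    · simp [hi]

theorem IsStep.sigma_mul_nonneg {z zNew : MPCIterate n m} {d : MPCStepData n m}
    (h : P.IsStep p Q z d zNew) (hz : P.IsAdmissible z) :
    0 ≤ d.sigma * dualityMeasure Q z.s z.lam := by
  refine mul_nonneg ?_ (dualityMeasure_nonneg hz.s_pos hz.lam_pos)
  rw [h.sigma_eq]
  exact pow_nonneg (sub_nonneg.2 h.alphaAff_eq.1.1.2) 3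

/-- These two bounds are all that the estimates require of the mixing rule. -/
theorem IsStep.gamma_mem_Icc {z zNew : MPCIterate n m} {d : MPCStepData n m}
    (h : P.IsStep p Q z d zNew) (hz : P.IsAdmissible z) (hp : p.Valid P) :
    d.gamma ∈ Set.Icc (0 : ℝ) 1 := by
  have hτ := hp.tau_mem.1
  have hσ := h.sigma_mul_nonneg hz
  have h1 := h.gamma1_eq.1.1
  have ha := euclNorm_nonneg d.dxAff
  have hc := euclNorm_nonneg d.dxCor
  by_cases hQ : Q = ∅
  · simp [h.gamma_empty hQ]
  by_cases hx : d.dxCor = 0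
  · simp [h.gamma_one hQ hx]
  by_cases h0 : d.sigma * dualityMeasure Q z.s z.lam = 0
  · rw [h.gamma_min_zero hQ hx h0]
    exact ⟨le_min h1.1 (by positivity), (min_le_left _ _).trans h1.2⟩
  · rw [h.gamma_min hQ hx h0]
    exact ⟨le_min h1.1 (le_min (by positivity) (mul_nonneg hτ (div_nonneg ha hσ))),
      (min_le_left _ _).trans h1.2⟩

end CQP


/-! ### Asymptotics of steps near the solution -/

namespace CQP

variable {n m : ℕ} {P : CQP n m} {p : MPCParams n m} {xStar : Fin n → ℝ} {lamStar : Fin m → ℝ}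
  {Q : Finset (Fin m)}

/-- The Euclidean distance of the primal-dual pair of an iterate to `(xStar, lamStar)`. -/
noncomputable def distTo (xStar : Fin n → ℝ) (lamStar : Fin m → ℝ) (z : MPCIterate n m) : ℝ :=
  euclNorm (Sum.elim (z.x - xStar) (z.lam - lamStar))

theorem isBigO_x_sub {T : Type} (l : Filter T) (z : T → MPCIterate n m) (xStar : Fin n → ℝ)
    (lamStar : Fin m → ℝ) : (fun t => (z t).x - xStar) =O[l] fun t => distTo xStar lamStar (z t) :=
  isBigO_pi.2 fun i => isBigO_pi.1 (isBigO_of_euclNorm (l := l)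
    (fun t => Sum.elim ((z t).x - xStar) ((z t).lam - lamStar))) (Sum.inl i)

theorem isBigO_lam_sub {T : Type} (l : Filter T) (z : T → MPCIterate n m) (xStar : Fin n → ℝ)
    (lamStar : Fin m → ℝ) :
    (fun t => (z t).lam - lamStar) =O[l] fun t => distTo xStar lamStar (z t) :=
  isBigO_pi.2 fun i => isBigO_pi.1 (isBigO_of_euclNorm (l := l)
    (fun t => Sum.elim ((z t).x - xStar) ((z t).lam - lamStar))) (Sum.inr i)

/-- A family of steps with working set `Q` whose inputs tend to a strict second-order solution. -/
structure StepFamily (P : CQP n m) (p : MPCParams n m) (xStar : Fin n → ℝ) (lamStar : Fin m → ℝ)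
    (Q : Finset (Fin m)) {T : Type} (l : Filter T) (z zNew : T → MPCIterate n m)
    (d : T → MPCStepData n m) : Prop where
  valid : p.Valid P
  solution : P.SecondOrderStrict xStar lamStar
  active_subset : P.active xStar ⊆ (Q : Set (Fin m))
  admissible : ∀ t, P.IsAdmissible (z t)
  step : ∀ t, P.IsStep p Q (z t) (d t) (zNew t)
  tendsto_dist : Tendsto (fun t => distTo xStar lamStar (z t)) l (𝓝 0)

namespace StepFamily

variable {T : Type} {l : Filter T} {z zNew : T → MPCIterate n m} {d : T → MPCStepData n m}
  (F : StepFamily P p xStar lamStar Q l z zNew d)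

include F

theorem isBigO_s :
    (fun t => (z t).s - P.slack xStar) =O[l] fun t => distTo xStar lamStar (z t) := by
  have : (fun t => (z t).s - P.slack xStar) = fun t => P.A *ᵥ ((z t).x - xStar) := by
    funext t
    rw [(F.admissible t).s_eq, slack_sub_slack]
  rw [this]
  exact (P.A.isBigO_mulVec _).trans (isBigO_x_sub l z xStar lamStar)

theorem tendsto_lam : Tendsto (fun t => (z t).lam) l (𝓝 lamStar) :=
  tendsto_sub_nhds_zero_iff.1 ((isBigO_lam_sub l z xStar lamStar).trans_tendsto F.tendsto_dist)

theorem tendsto_s : Tendsto (fun t => (z t).s) l (𝓝 (P.slack xStar)) :=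
  tendsto_sub_nhds_zero_iff.1 (F.isBigO_s.trans_tendsto F.tendsto_dist)

theorem isBigO_one_of_isBigO_dist {E : Type*} [SeminormedAddCommGroup E] {g : T → E}
    (hg : g =O[l] fun t => distTo xStar lamStar (z t)) : g =O[l] fun _ => (1 : ℝ) :=
  hg.trans (F.tendsto_dist.isBigO_one ℝ)

theorem isBigO_dist_of_sq {E : Type*} [SeminormedAddCommGroup E] {g : T → E}
    (hg : g =O[l] fun t => distTo xStar lamStar (z t) ^ 2) :
    g =O[l] fun t => distTo xStar lamStar (z t) := by
  refine hg.trans ?_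
  simpa [sq] using (F.tendsto_dist.isBigO_one ℝ).mul (isBigO_refl _ l)

/-- The minimum is bounded by the slack at active indices and by the multiplier at inactive ones;
that quantity vanishes at the solution. -/
theorem isBigO_errorE : (fun t => P.errorE p (z t).x (z t).lam) =O[l]
    fun t => distTo xStar lamStar (z t) := by
  unfold errorE
  refine (p.normE.isBigO_comp _).trans (IsBigO.prod_left ?_ ?_)
  · refine (p.normV.isBigO_comp _).trans ?_
    have e : (fun t => P.H *ᵥ (z t).x + P.c - P.Aᵀ *ᵥ (z t).lam) =
        fun t => P.H *ᵥ ((z t).x - xStar) - P.Aᵀ *ᵥ ((z t).lam - lamStar) := by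
      funext t
      have := F.solution.kkt.stationarity
      rw [mulVec_sub, mulVec_sub]
      calc _ = P.H *ᵥ (z t).x + P.c - P.Aᵀ *ᵥ (z t).lam
            - (P.H *ᵥ xStar - P.Aᵀ *ᵥ lamStar + P.c) := by rw [this, sub_zero]
        _ = _ := by abel
    rw [e]
    exact ((P.H.isBigO_mulVec _).trans (isBigO_x_sub l z xStar lamStar)).sub
      ((P.Aᵀ.isBigO_mulVec _).trans (isBigO_lam_sub l z xStar lamStar))
  · refine (p.normW.isBigO_comp _).trans (isBigO_pi.2 fun i => ?_)
    by_cases hi : i ∈ P.active xStar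
    · refine IsBigO.trans (IsBigO.of_norm_le fun t => ?_) (isBigO_pi.1 F.isBigO_s i).norm_left
      rw [Real.norm_of_nonneg (le_min (abs_nonneg _) (abs_nonneg _)), Pi.sub_apply,
        slack_eq_zero_iff.2 hi, sub_zero, (F.admissible t).s_eq]
      exact min_le_left _ _
    · refine IsBigO.trans (IsBigO.of_norm_le fun t => ?_)
        (isBigO_pi.1 (isBigO_lam_sub l z xStar lamStar) i).norm_left
      rw [Real.norm_of_nonneg (le_min (abs_nonneg _) (abs_nonneg _)), Pi.sub_apply,
        F.solution.kkt.lam_eq_zero hi, sub_zero]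
      exact min_le_right _ _

theorem isBigO_regParam : (fun t => P.regParam p (z t).x (z t).lam) =O[l]
    fun t => distTo xStar lamStar (z t) := by
  have h : (fun t => P.errorE p (z t).x (z t).lam / p.Ebar) =O[l]
      fun t => distTo xStar lamStar (z t) := by
    simp only [div_eq_inv_mul]
    exact F.isBigO_errorE.const_mul_left _
  refine IsBigO.trans (IsBigO.of_norm_le fun t => ?_) h
  have h0 : 0 ≤ P.errorE p (z t).x (z t).lam / p.Ebar :=
    div_nonneg (apply_nonneg _ _) F.valid.Ebar_pos.le
  rw [regParam, Real.norm_of_nonneg (le_min zero_le_one h0)]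
  exact min_le_right _ _

theorem isBigO_of_newtonMap {w : T → (Fin n → ℝ) × (Fin m → ℝ)} {g : T → ℝ}
    (hw : (fun t => newtonMap P.A Q (P.H + P.regParam p (z t).x (z t).lam • p.R) (z t).s (z t).lam
      (w t)) =O[l] g) : w =O[l] g :=
  F.solution.isBigO_of_newtonMap F.active_subset (F.isBigO_regParam.trans_tendsto F.tendsto_dist)
    F.tendsto_s F.tendsto_lam hw

theorem isBigO_aff : (fun t => ((z t).x + (d t).dxAff - xStar,
      fun i => if i ∈ Q then (z t).lam i + (d t).dlamAff i - lamStar i else 0)) =O[l]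
    fun t => distTo xStar lamStar (z t) ^ 2 := by
  refine F.isBigO_of_newtonMap ?_
  simp_rw [fun t => (F.step t).newtonMap_aff (F.admissible t) F.solution.kkt F.active_subset, sq]
  refine IsBigO.prod_left ?_ (isBigO_pi.2 fun i => ?_)
  · exact F.isBigO_regParam.smul ((p.R.isBigO_mulVec _).trans (isBigO_x_sub l z xStar lamStar))
  · by_cases hi : i ∈ Q
    · simp only [hi, if_true]
      exact (isBigO_pi.1 F.isBigO_s i).mul (isBigO_pi.1 (isBigO_lam_sub l z xStar lamStar) i)
    · simp only [hi, if_false]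
      exact isBigO_zero _ _

theorem isBigO_x_add_dxAff : (fun t => (z t).x + (d t).dxAff - xStar) =O[l]
    fun t => distTo xStar lamStar (z t) ^ 2 :=
  (isBigO_prod_left.1 F.isBigO_aff).1

theorem isBigO_lam_add_dlamAff {i : Fin m} (hi : i ∈ Q) :
    (fun t => (z t).lam i + (d t).dlamAff i - lamStar i) =O[l]
    fun t => distTo xStar lamStar (z t) ^ 2 := by
  simpa [hi] using isBigO_pi.1 (isBigO_prod_left.1 F.isBigO_aff).2 i

theorem isBigO_dxAff : (fun t => (d t).dxAff) =O[l] fun t => distTo xStar lamStar (z t) := by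
  simpa using (F.isBigO_dist_of_sq F.isBigO_x_add_dxAff).sub (isBigO_x_sub l z xStar lamStar)

theorem isBigO_dsAff (i : Fin m) :
    (fun t => (d t).dsAff i) =O[l] fun t => distTo xStar lamStar (z t) := by
  simp_rw [fun t => (F.step t).dsAff_eq]
  exact isBigO_pi.1 ((P.A.isBigO_mulVec _).trans F.isBigO_dxAff) i

theorem isBigO_dlamAff {i : Fin m} (hi : i ∈ Q) :
    (fun t => (d t).dlamAff i) =O[l] fun t => distTo xStar lamStar (z t) := by
  simpa using (F.isBigO_dist_of_sq (F.isBigO_lam_add_dlamAff hi)).sub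
    (isBigO_pi.1 (isBigO_lam_sub l z xStar lamStar) i)

/-! ### Affine step size, centering and corrector -/

theorem isBigO_div_lam {i : Fin m} (hi : i ∈ P.active xStar) {g : T → ℝ}
    (hg : g =O[l] fun t => distTo xStar lamStar (z t)) :
    (fun t => g t / (z t).lam i) =O[l] fun t => distTo xStar lamStar (z t) := by
  have := ((tendsto_pi_nhds.1 F.tendsto_lam i).inv₀
    (F.solution.strict_complementarity i hi).ne').isBigO_one ℝ
  simpa [div_eq_mul_inv] using hg.mul this

theorem isBigO_div_s {i : Fin m} (hi : i ∉ P.active xStar) {g : T → ℝ}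
    (hg : g =O[l] fun t => distTo xStar lamStar (z t)) :
    (fun t => g t / (z t).s i) =O[l] fun t => distTo xStar lamStar (z t) := by
  have := ((tendsto_pi_nhds.1 F.tendsto_s i).inv₀
    (F.solution.kkt.slack_pos hi).ne').isBigO_one ℝ
  simpa [div_eq_mul_inv] using hg.mul this

omit F in
theorem dist_nonneg (t : T) : 0 ≤ distTo xStar lamStar (z t) := euclNorm_nonneg _

/-- Linearized complementarity solved for the slack step: to first order, it removes the whole
slack, with an error relative to `sᵢ`. -/
theorem dsAff_eq_of_mem {i : Fin m} (hi : i ∈ Q) (t : T) :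
    (d t).dsAff i = -(z t).s i * (1 + (d t).dlamAff i / (z t).lam i) := by
  have h1 := ((F.admissible t).s_pos i).ne'
  have h2 := ((F.admissible t).lam_pos i).ne'
  rw [(F.step t).dlamAff_eq i hi]
  field_simp
  ring

/-- Inactive slacks have positive limits, so small steps are harmless; active slacks tend to zero
and need the relative bound. -/
theorem eventually_s_add_nonneg {δ θ : T → Fin m → ℝ}
    (hδ : ∀ i, (fun t => δ t i) =O[l] fun t => distTo xStar lamStar (z t))
    (hθ : ∀ i ∈ P.active xStar, (fun t => θ t i) =O[l] fun t => distTo xStar lamStar (z t))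
    (h : ∀ i ∈ P.active xStar, ∀ t, -(z t).s i * (1 + θ t i) ≤ δ t i) :
    ∀ᶠ B : ℝ in atTop, ∀ᶠ t in l, ∀ i,
      0 ≤ (z t).s i + (1 - B * distTo xStar lamStar (z t)) * δ t i := by
  simp_rw [eventually_all]
  intro i
  by_cases hi : i ∈ P.active xStar
  · exact eventually_nonneg_add_mul_of_relative (fun t => (F.admissible t).s_pos i)
      F.tendsto_dist dist_nonneg (hθ i hi) (Eventually.of_forall (h i hi))
  · exact eventually_nonneg_add_mul_of_tendsto_pos (F.solution.kkt.slack_pos hi)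
      (tendsto_pi_nhds.1 F.tendsto_s i) ((hδ i).trans_tendsto F.tendsto_dist) F.tendsto_dist

/-- Slacks and multipliers exchange roles: here the inactive indices of `Q` need the relative bound.
-/
theorem eventually_lam_add_nonneg : ∀ᶠ B : ℝ in atTop, ∀ᶠ t in l, ∀ i ∈ Q,
    0 ≤ (z t).lam i + (1 - B * distTo xStar lamStar (z t)) * (d t).dlamAff i := by
  simp_rw [eventually_all]
  intro i
  by_cases hQ : i ∈ Q
  · simp only [hQ, true_imp_iff]
    by_cases hi : i ∈ P.active xStar
    · exact eventually_nonneg_add_mul_of_tendsto_pos (F.solution.strict_complementarity i hi)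
        (tendsto_pi_nhds.1 F.tendsto_lam i) ((F.isBigO_dlamAff hQ).trans_tendsto F.tendsto_dist)
        F.tendsto_dist
    · refine eventually_nonneg_add_mul_of_relative (fun t => (F.admissible t).lam_pos i)
        F.tendsto_dist dist_nonneg (F.isBigO_div_s hi (F.isBigO_dsAff i))
        (Eventually.of_forall fun t => ?_)
      rw [(F.step t).dlamAff_eq i hQ]
      exact le_of_eq (by ring)
  · simp [hQ]

theorem isBigO_one_sub_alphaAff : (fun t => 1 - (d t).alphaAff) =O[l]
    fun t => distTo xStar lamStar (z t) := by
  have h := F.eventually_s_add_nonneg (δ := fun t => (d t).dsAff)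
    (θ := fun t i => (d t).dlamAff i / (z t).lam i) F.isBigO_dsAff
    (fun i hi => F.isBigO_div_lam hi (F.isBigO_dlamAff (F.active_subset hi)))
    (fun i hi t => (F.dsAff_eq_of_mem (F.active_subset hi) t).ge)
  -- With one `B` for all constraints, `1 - B e` is eventually feasible, and maximality of
  -- `alphaAff` gives `1 - alphaAff ≤ B e`.
  obtain ⟨B, ⟨h1, h2⟩, hB⟩ :=
    ((h.and F.eventually_lam_add_nonneg).and (eventually_ge_atTop 0)).exists
  have hBe : Tendsto (fun t => B * distTo xStar lamStar (z t)) l (𝓝 0) := by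
    simpa using F.tendsto_dist.const_mul B
  refine IsBigO.of_bound B ?_
  filter_upwards [h1, h2, hBe.eventually (gt_mem_nhds one_pos)] with t h3 h4 h5
  have hα := (F.step t).alphaAff_eq
  have h6 : 0 ≤ B * distTo xStar lamStar (z t) := mul_nonneg hB (dist_nonneg t)
  have := hα.2 ⟨⟨by linarith, by linarith⟩, h3, h4⟩
  rw [Real.norm_of_nonneg (sub_nonneg.2 hα.1.1.2), Real.norm_of_nonneg (dist_nonneg t)]
  linarith

theorem isBigO_centering : (fun t => (d t).sigma * dualityMeasure Q (z t).s (z t).lam) =O[l]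
    fun t => distTo xStar lamStar (z t) ^ 2 := by
  have h1 : (fun t => (d t).sigma) =O[l] fun t => distTo xStar lamStar (z t) ^ 2 := by
    simp_rw [fun t => (F.step t).sigma_eq]
    -- Two of the three factors of `sigma` suffice; the third is merely bounded.
    have a := F.isBigO_one_sub_alphaAff
    simpa [← pow_succ] using (a.pow 2).mul (F.isBigO_one_of_isBigO_dist a)
  simpa using h1.mul
    (isBigO_dualityMeasure Q (F.tendsto_s.isBigO_one ℝ) (F.tendsto_lam.isBigO_one ℝ))

theorem isBigO_cor : (fun t => ((d t).dxCor, fun i => if i ∈ Q then (d t).dlamCor i else 0)) =O[l]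
    fun t => distTo xStar lamStar (z t) ^ 2 := by
  refine F.isBigO_of_newtonMap ?_
  simp_rw [fun t => (F.step t).newtonMap_cor]
  refine IsBigO.prod_left (isBigO_zero _ _) (isBigO_pi.2 fun i => ?_)
  by_cases hi : i ∈ Q
  · simp only [hi, if_true]
    refine F.isBigO_centering.sub ?_
    simpa only [sq] using (F.isBigO_dsAff i).mul (F.isBigO_dlamAff hi)
  · simp only [hi, if_false]
    exact isBigO_zero _ _

theorem isBigO_gamma : (fun t => (d t).gamma) =O[l] fun _ => (1 : ℝ) := by
  refine IsBigO.of_bound 1 (Eventually.of_forall fun t => ?_)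
  have h := (F.step t).gamma_mem_Icc (F.admissible t) F.valid
  rw [Real.norm_of_nonneg h.1, norm_one, mul_one]
  exact h.2

theorem isBigO_gamma_smul_dxCor : (fun t => (d t).gamma • (d t).dxCor) =O[l]
    fun t => distTo xStar lamStar (z t) ^ 2 := by
  simpa using F.isBigO_gamma.smul (isBigO_prod_left.1 F.isBigO_cor).1

theorem isBigO_gamma_mul_dlamCor {i : Fin m} (hi : i ∈ Q) :
    (fun t => (d t).gamma * (d t).dlamCor i) =O[l]
    fun t => distTo xStar lamStar (z t) ^ 2 := by
  have := F.isBigO_gamma.mul (isBigO_pi.1 (isBigO_prod_left.1 F.isBigO_cor).2 i)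
  simpa [hi] using this

/-! ### The combined direction and the new iterate -/

theorem isBigO_x_add_dx : (fun t => (z t).x + (d t).dx - xStar) =O[l]
    fun t => distTo xStar lamStar (z t) ^ 2 := by
  refine (F.isBigO_x_add_dxAff.add F.isBigO_gamma_smul_dxCor).congr_left fun t => ?_
  rw [(F.step t).dx_eq]
  abel

theorem isBigO_lam_add_dlam {i : Fin m} (hi : i ∈ Q) :
    (fun t => (z t).lam i + (d t).dlam i - lamStar i) =O[l]
    fun t => distTo xStar lamStar (z t) ^ 2 := by
  refine ((F.isBigO_lam_add_dlamAff hi).add (F.isBigO_gamma_mul_dlamCor hi)).congr_left fun t => ?_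
  rw [(F.step t).dlam_eq i hi]
  ring

theorem isBigO_dx : (fun t => (d t).dx) =O[l] fun t => distTo xStar lamStar (z t) := by
  simpa using (F.isBigO_dist_of_sq F.isBigO_x_add_dx).sub (isBigO_x_sub l z xStar lamStar)

theorem isBigO_dlam {i : Fin m} (hi : i ∈ Q) :
    (fun t => (d t).dlam i) =O[l] fun t => distTo xStar lamStar (z t) := by
  simpa using (F.isBigO_dist_of_sq (F.isBigO_lam_add_dlam hi)).sub
    (isBigO_pi.1 (isBigO_lam_sub l z xStar lamStar) i)

theorem isBigO_ds (i : Fin m) :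
    (fun t => (d t).ds i) =O[l] fun t => distTo xStar lamStar (z t) := by
  have e : ∀ t, (d t).ds = P.A *ᵥ (d t).dx := fun t => by
    rw [(F.step t).ds_eq, (F.step t).dx_eq, (F.step t).dsAff_eq, (F.step t).dsCor_eq, mulVec_add,
      mulVec_smul]
  simp_rw [e]
  exact isBigO_pi.1 ((P.A.isBigO_mulVec _).trans F.isBigO_dx) i

/-- In the step of an active slack, the second-order term of the corrector is relative to the
slack, and the centering term is favourable. -/
theorem le_ds {i : Fin m} (hi : i ∈ Q) (t : T) :
    -(z t).s i * (1 + ((d t).dlam i / (z t).lam i - (d t).gamma *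
      (1 + (d t).dlamAff i / (z t).lam i) * ((d t).dlamAff i / (z t).lam i))) ≤ (d t).ds i := by
  have hs := (F.admissible t).s_pos i
  have hl := (F.admissible t).lam_pos i
  have h1 := F.dsAff_eq_of_mem hi t
  have h2 := (F.step t).dlamCor_eq i hi
  have h3 := (F.step t).gamma_mem_Icc (F.admissible t) F.valid
  have h4 := mul_nonneg h3.1 ((F.step t).sigma_mul_nonneg (F.admissible t))
  have h5 : (d t).ds i = (d t).dsAff i + (d t).gamma * (d t).dsCor i := by
    rw [(F.step t).ds_eq]; rfl
  have h6 : (d t).dsCor i = ((d t).sigma * dualityMeasure Q (z t).s (z t).lam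
      - (d t).dsAff i * (d t).dlamAff i - (z t).s i * (d t).dlamCor i) / (z t).lam i := by
    rw [eq_div_iff hl.ne']
    linarith
  have h7 := div_nonneg h4 hl.le
  rw [h5, h6, (F.step t).dlam_eq i hi, h1, ← sub_nonneg]
  -- The two sides differ by exactly `γσμ/λᵢ`.
  refine h7.trans (le_of_eq ?_)
  field_simp
  ring

theorem isBigO_one_sub_alphaP : (fun t => 1 - (d t).alphaP) =O[l]
    fun t => distTo xStar lamStar (z t) := by
  have h := F.eventually_s_add_nonneg (δ := fun t => (d t).ds)
    (θ := fun t i => (d t).dlam i / (z t).lam i - (d t).gamma *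
      (1 + (d t).dlamAff i / (z t).lam i) * ((d t).dlamAff i / (z t).lam i)) F.isBigO_ds
    (fun i hi => by
      have hQ : i ∈ Q := F.active_subset hi
      have a := F.isBigO_div_lam hi (F.isBigO_dlamAff hQ)
      have b := F.isBigO_gamma.mul
        ((isBigO_refl (fun _ => (1 : ℝ)) l).add (F.isBigO_one_of_isBigO_dist a))
      refine (F.isBigO_div_lam hi (F.isBigO_dlam hQ)).sub ?_
      simpa using b.mul a)
    (fun i hi t => F.le_ds (F.active_subset hi) t)
  obtain ⟨B, h1, hB⟩ := (h.and (eventually_ge_atTop 0)).exists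
  have hsum : (fun t => B * distTo xStar lamStar (z t) + euclNorm (d t).dx) =O[l]
      fun t => distTo xStar lamStar (z t) :=
    (isBigO_const_mul_self B _ l).add ((isBigO_euclNorm _).trans F.isBigO_dx)
  refine IsBigO.trans (IsBigO.of_bound 1 ?_) hsum
  filter_upwards [h1] with t h3
  have h6 : 0 ≤ B * distTo xStar lamStar (z t) := mul_nonneg hB (dist_nonneg t)
  have h7 := euclNorm_nonneg (d t).dx
  have := (F.step t).alphaP_eq.mem_Icc h3 (by linarith) h7
  rw [Real.norm_of_nonneg (sub_nonneg.2 this.2), Real.norm_of_nonneg (by positivity)]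
  linarith [this.1]

theorem isBigO_dist_sq : (fun t => euclNorm (Sum.elim ((zNew t).x - xStar)
    ((zNew t).lamTilde - lamStar))) =O[l] fun t => distTo xStar lamStar (z t) ^ 2 := by
  refine (isBigO_euclNorm _).trans (isBigO_pi.2 ?_)
  have hx : (fun t => (zNew t).x - xStar) =O[l] fun t => distTo xStar lamStar (z t) ^ 2 := by
    -- Damping changes the full step by `(1 - αₚ)Δx`, a product of two `O(e)` factors.
    have h := F.isBigO_one_sub_alphaP.smul F.isBigO_dx
    simp only [smul_eq_mul, ← sq] at h
    refine (F.isBigO_x_add_dx.sub h).congr_left fun t => ?_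
    rw [(F.step t).x_eq, sub_smul, one_smul]
    abel
  rintro (j | i)
  · exact isBigO_pi.1 hx j
  · by_cases hi : i ∈ Q
    · refine (F.isBigO_lam_add_dlam hi).congr_left fun t => ?_
      simp [(F.step t).lamTilde_mem i hi]
    · refine (isBigO_zero _ _).congr_left fun t => ?_
      simp [(F.step t).lamTilde_notMem i hi,
        F.solution.kkt.lam_eq_zero fun h => hi (F.active_subset h)]

end StepFamily

/-! ### Uniform constants -/

theorem SecondOrderStrict.exists_step_bound (hStar : P.SecondOrderStrict xStar lamStar)
    (hp : p.Valid P) (hQ : P.active xStar ⊆ (Q : Set (Fin m))) :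
    ∃ ρ C : ℝ, 0 < ρ ∧ 0 < C ∧ ∀ (z zNew : MPCIterate n m) (d : MPCStepData n m),
      P.IsAdmissible z → distTo xStar lamStar z < ρ → P.IsStep p Q z d zNew →
      euclNorm (Sum.elim (zNew.x - xStar) (zNew.lamTilde - lamStar)) ≤
        C * distTo xStar lamStar z ^ 2 := by
  -- The index type consists of all admissible steps, filtered by the input's distance to the
  -- solution. A big-O along this filter is therefore a bound uniform over all nearby inputs.
  let T := {w : MPCIterate n m × MPCIterate n m × MPCStepData n m //
    P.IsAdmissible w.1 ∧ P.IsStep p Q w.1 w.2.2 w.2.1}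
  have F : StepFamily P p xStar lamStar Q
      (comap (fun t : T => distTo xStar lamStar t.1.1) (𝓝 0))
      (fun t => t.1.1) (fun t => t.1.2.1) (fun t => t.1.2.2) :=
    ⟨hp, hStar, hQ, fun t => t.2.1, fun t => t.2.2, tendsto_comap⟩
  obtain ⟨C, hC, hb⟩ := F.isBigO_dist_sq.exists_pos
  obtain ⟨ρ, hρ, h⟩ := Metric.eventually_nhds_iff.1 (eventually_comap.1 hb.bound)
  refine ⟨ρ, C, hρ, hC, fun z zNew d hz hlt hs => ?_⟩
  have h0 : 0 ≤ distTo xStar lamStar z := euclNorm_nonneg _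
  have := h (y := distTo xStar lamStar z) (by rwa [Real.dist_0_eq_abs, abs_of_nonneg h0])
    ⟨(z, zNew, d), hz, hs⟩ rfl
  rwa [Real.norm_of_nonneg (euclNorm_nonneg _), Real.norm_of_nonneg (sq_nonneg _)] at this

end CQP

theorem theorem2 {n m : ℕ} (P : CQP n m) (p : MPCParams n m) (hp : p.Valid P)
    (xStar : Fin n → ℝ) (lamStar : Fin m → ℝ)
    (hStar : P.SecondOrderStrict xStar lamStar)
    (hEps : p.eps = 0)
    (hMax : ∀ i, lamStar i < p.lamMax) :
    ∃ ρ C : ℝ, 0 < ρ ∧ 0 < C ∧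
      ∀ (Q : Finset (Fin m)) (z zNew : MPCIterate n m) (d : MPCStepData n m),
        P.IsAdmissible z →
        ¬ P.Stops p z →
        euclNorm (Sum.elim (z.x - xStar) (z.lam - lamStar)) < ρ →
        P.active xStar ⊆ (Q : Set (Fin m)) →
        P.IsStep p Q z d zNew →
        euclNorm (Sum.elim (zNew.x - xStar) (zNew.lamTilde - lamStar)) ≤
          C * euclNorm (Sum.elim (z.x - xStar) (z.lam - lamStar)) ^ 2 := by
  have key : ∀ Q : Finset (Fin m), ∃ ρ C : ℝ, 0 < ρ ∧ 0 < C ∧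
      (P.active xStar ⊆ (Q : Set (Fin m)) →
      ∀ (z zNew : MPCIterate n m) (d : MPCStepData n m),
        P.IsAdmissible z → CQP.distTo xStar lamStar z < ρ → P.IsStep p Q z d zNew →
        euclNorm (Sum.elim (zNew.x - xStar) (zNew.lamTilde - lamStar)) ≤
          C * CQP.distTo xStar lamStar z ^ 2) := fun Q => by
    by_cases hQ : P.active xStar ⊆ (Q : Set (Fin m))
    · obtain ⟨ρ, C, hρ, hC, h⟩ := hStar.exists_step_bound hp hQ
      exact ⟨ρ, C, hρ, hC, fun _ => h⟩
    · exact ⟨1, 1, one_pos, one_pos, fun h => absurd h hQ⟩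
  choose ρ C hρ hC h using key
  -- There are finitely many working sets: the smallest radius and the largest constant serve them
  -- all.
  obtain ⟨Q₁, hQ₁⟩ := Finite.exists_min ρ
  obtain ⟨Q₂, hQ₂⟩ := Finite.exists_max C
  exact ⟨ρ Q₁, C Q₂, hρ Q₁, hC Q₂, fun Q z zNew d hz _ hlt hQ hs =>
    (h Q hQ z zNew d hz (hlt.trans_le (hQ₁ Q)) hs).trans
      (mul_le_mul_of_nonneg_right (hQ₂ Q) (sq_nonneg _))⟩
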